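/- Let $A$ be a commutative Noetherian ring, let $r\ge 2$, and let $P$ be a finitely generated projective $A$-module of constant rank $r$. Let $s\in A$ be a Lindel element for $P$, that is: (i) $P_s$ is free over $A_s$; (ii) there are $p_1,\dots,p_r\in P$ and $\phi_1,\dots,\phi_r\in P^*=\operatorname{Hom}_A(P,A)$ with $\phi_i(p_j)=s\,\delta_{ij}$ for all $i,j$ and (iii) $sP\subset Ap_1+\dots+Ap_r$; (iv) the image of $s$ in $A_{\mathrm{red}}$ is a non-zero-divisor; (v) $(0:sA)=(0:s^2A)$. For a module $M$ over a commutative ring $B$, let $\operatorname{Um}(M)$ be the set of $m\in M$ with $\phi(m)=1$ for some $\phi\in M^*=\operatorname{Hom}_B(M,B)$, put $\operatorname{Um}_n(B)=\operatorname{Um}(B^n)$, and let $E(M)\subset\operatorname{Aut}_B(M)$ be the subgroup generated by the automorphisms $q\mapsto q+\varphi(q)p$ with $p\in M$, $\varphi\in M^*$, $\varphi(p)=0$, and $p\in\operatorname{Um}(M)$ or $\varphi\in\operatorname{Um}(M^*)$. Let $E_n(B)\subset SL_n(B)$ be the subgroup generated by the elementary matrices $I+c\,e_{ij}$ ($c\in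 B$, $i\neq j$), acting on rows by right multiplication. Let $\operatorname{Um}(A\oplus P,s^2A)$ be the set of $(a,p)\in\operatorname{Um}(A\oplus P)$ with $a\in 1+s^2A$ and $p\in s^2P$. Let $R=A[X]/(X^2-s^2X)$ and suppose that $E_{r+1}(R)$ acts transitively on $\operatorname{Um}_{r+1}(R)$. Then $E(A\oplus P)$ acts transitively on $\operatorname{Um}(A\oplus P,s^2A)$, in the sense that any two elements of $\operatorname{Um}(A\oplus P,s^2A)$ (in particular, any element and $(1,0)$) are mapped one to the other by an element of $E(A\oplus P)$. -/

import Mathlib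

universe u v

namespace Lindel

open Polynomial

/-- The set `Um(M)` of unimodular elements of a module: those mapped to `1` by some linear form. -/
def Um (A : Type u) [CommRing A] (M : Type v) [AddCommGroup M] [Module A M] : Set M :=
  {m | ∃ φ : Module.Dual A M, φ m = 1}

/-- The set `Um(A ⊕ M, J)` of unimodular elements `(a, m)` of `A ⊕ M` with `a ∈ 1 + J` and
`m ∈ J M`. -/
def UmRel (A : Type u) [CommRing A] (M : Type v) [AddCommGroup M] [Module A M] (J : Ideal A) :
    Set (A × M) :=
  {x | x ∈ Um A (A × M) ∧ x.1 - 1 ∈ J ∧ x.2 ∈ J • (⊤ : Submodule A M)}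

/-- The group `E(M)`: the subgroup of `Aut(M)` generated by the transvections
`q ↦ q + φ(q) p`, where `φ(p) = 0` and `p` is unimodular in `M` or `φ` is unimodular in `M^*`. -/
def E (A : Type u) [CommRing A] (M : Type v) [AddCommGroup M] [Module A M] :
    Subgroup (M ≃ₗ[A] M) :=
  Subgroup.closure {σ | ∃ (φ : Module.Dual A M) (p : M) (h : φ p = 0),
    (p ∈ Um A M ∨ φ ∈ Um A (Module.Dual A M)) ∧ σ = LinearEquiv.transvection h}

/-- The elementary group `E_n(R)`: the subgroup of `SL_n(R)` generated by the elementary matrices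
`1 + c e_{ij}`, `i ≠ j`. -/
def En (n : ℕ) (R : Type u) [CommRing R] : Subgroup (Matrix.SpecialLinearGroup (Fin n) R) :=
  Subgroup.closure {g | ∃ (i j : Fin n) (c : R), i ≠ j ∧
    (g : Matrix (Fin n) (Fin n) R) = Matrix.transvection i j c}

/-- `s` is a Lindel element for the module `P` (of rank `r`). -/
structure IsLindelElement {A : Type u} [CommRing A] (P : Type v) [AddCommGroup P] [Module A P]
    (r : ℕ) (s : A) : Prop where
  free_away : Module.Free (Localization.Away s) (LocalizedModule (Submonoid.powers s) P)
  exists_dual : ∃ (p : Fin r → P) (φ : Fin r → Module.Dual A P),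
    (∀ i j, φ i (p j) = if i = j then s else 0) ∧
    ∀ x : P, s • x ∈ Submodule.span A (Set.range p)
  image_reduced : Ideal.Quotient.mk (nilradical A) s ∈ nonZeroDivisors (A ⧸ nilradical A)
  annihilator_eq : (Ideal.span {s}).annihilator = (Ideal.span {s ^ 2}).annihilator

/-- The ring `A[X]/(X^2 - s^2 X)`. -/
abbrev DoubleRing (A : Type u) [CommRing A] (s : A) : Type u :=
  A[X] ⧸ Ideal.span {(X ^ 2 - C (s ^ 2) * X : A[X])}

end Lindel

/-! A transvection moves `x` to the image under `(b, f) ↦ (b, ∑ f i • p i)` of a row `e₀ + s² w`,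
and this row is unimodular. Over `A[X]/(X² - s² X)` it lifts to `e₀ + X w`, still unimodular, so
some elementary `g` carries the lift to `e₀`. Evaluating at the roots `0` and `s²` shows that `g(0)`
fixes `e₀` and that `g(s²) g(0)⁻¹` carries `e₀ + s² w` to `e₀`. This quotient is a product of
conjugates of matrices `E_ij(s² b)`. By a relative form of Suslin's normality argument
(`conj_transvection_mem`), such conjugates are products of matrices `E_ij(s c)`. The latter lift to
`E(A ⊕ P)` (`transvection_mem_liftable`), because `φ i (p j) = s δ_ij`. Hence `x` is carried to `(1,
0)`. -/

open Matrix

namespace Lindel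

/-! ### Conjugates of elementary matrices with entries in `s² A` -/

section Matrices

variable {A : Type u} [CommRing A] {n : Type*} [Fintype n] [DecidableEq n]

theorem one_add_vecMulVec_mul_left {v v' w : n → A} (h : w ⬝ᵥ v' = 0) :
    (1 + vecMulVec v w) * (1 + vecMulVec v' w) = 1 + vecMulVec (v + v') w := by
  simp [mul_add, add_mul, vecMulVec_mul_vecMulVec, h, add_vecMulVec]
  abel

theorem one_add_vecMulVec_mul_right {v w w' : n → A} (h : w ⬝ᵥ v = 0) :
    (1 + vecMulVec v w) * (1 + vecMulVec v w') = 1 + vecMulVec v (w + w') := by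
  simp [mul_add, add_mul, vecMulVec_mul_vecMulVec, h, vecMulVec_add]
  abel

theorem one_add_vecMulVec_sum_left_mem (H : Submonoid (Matrix n n A)) {ι : Type*} (t : Finset ι)
    (v : ι → n → A) (w : n → A) (h : ∀ k ∈ t, w ⬝ᵥ v k = 0)
    (hH : ∀ k ∈ t, 1 + vecMulVec (v k) w ∈ H) :
    1 + vecMulVec (∑ k ∈ t, v k) w ∈ H := by
  classical
  induction t using Finset.induction_on with
  | empty => simp [one_mem]
  | insert k t hk ih =>
    rw [Finset.sum_insert hk, ← one_add_vecMulVec_mul_left]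
    · exact mul_mem (hH k (by simp)) (ih (fun l hl => h l (by simp [hl]))
        (fun l hl => hH l (by simp [hl])))
    · rw [dotProduct_sum]
      exact Finset.sum_eq_zero fun l hl => h l (by simp [hl])

theorem one_add_vecMulVec_sum_right_mem (H : Submonoid (Matrix n n A)) {ι : Type*} (t : Finset ι)
    (v : n → A) (w : ι → n → A) (h : ∀ k ∈ t, w k ⬝ᵥ v = 0)
    (hH : ∀ k ∈ t, 1 + vecMulVec v (w k) ∈ H) :
    1 + vecMulVec v (∑ k ∈ t, w k) ∈ H := by
  classical
  induction t using Finset.induction_on with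
  | empty => simp [one_mem]
  | insert k t hk ih =>
    rw [Finset.sum_insert hk, ← one_add_vecMulVec_mul_right]
    · exact mul_mem (hH k (by simp)) (ih (fun l hl => h l (by simp [hl]))
        (fun l hl => hH l (by simp [hl])))
    · exact h k (by simp)

theorem transvection_eq_one_add_vecMulVec {n : Type*} [DecidableEq n] (i j : n) (c d : A) :
    transvection i j (c * d) = 1 + vecMulVec (Pi.single i c) (Pi.single j d) := by
  rw [transvection]
  congr 1
  ext k l
  by_cases hk : i = k <;> by_cases hl : j = l <;>
    simp [vecMulVec_apply, hk, hl, Ne.symm]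

variable (H : Submonoid (Matrix n n A)) {s : A}

theorem one_add_vecMulVec_single_right_mem
    (hH : ∀ (i j : n) (c : A), i ≠ j → transvection i j (s * c) ∈ H)
    (m : n) {v : n → A} (hv : v m = 0) :
    1 + vecMulVec (s • v) (Pi.single m 1) ∈ H := by
  have : s • v = ∑ k, Pi.single k (s * v k) := (Finset.univ_sum_single (s • v)).symm
  rw [this]
  refine one_add_vecMulVec_sum_left_mem H _ _ _ (fun k _ => ?_) (fun k _ => ?_)
  · by_cases hk : k = m
    · subst hk; simp [hv]
    · simp [Ne.symm hk]
  · rw [← transvection_eq_one_add_vecMulVec, mul_one]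
    by_cases hk : k = m
    · subst hk; simp [hv, one_mem]
    · exact hH _ _ _ hk

theorem one_add_vecMulVec_single_left_mem
    (hH : ∀ (i j : n) (c : A), i ≠ j → transvection i j (s * c) ∈ H)
    (m : n) {w : n → A} (hw : w m = 0) :
    1 + vecMulVec (Pi.single m 1) (s • w) ∈ H := by
  have : s • w = ∑ k, Pi.single k (s * w k) := (Finset.univ_sum_single (s • w)).symm
  rw [this]
  refine one_add_vecMulVec_sum_right_mem H _ _ _ (fun k _ => ?_) (fun k _ => ?_)
  · by_cases hk : k = m
    · subst hk; simp [hw]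
    · simp [hk]
  · rw [← transvection_eq_one_add_vecMulVec, one_mul]
    by_cases hk : k = m
    · subst hk; simp [hw, one_mem]
    · exact hH _ _ _ (Ne.symm hk)

/-- The matrix is the commutator of `1 + s v e_m` and `1 + s e_m w`; each of the two contributes one
factor `s`. -/
theorem one_add_vecMulVec_mem_of_apply_eq_zero
    (hH : ∀ (i j : n) (c : A), i ≠ j → transvection i j (s * c) ∈ H)
    (m : n) {v w : n → A} (hv : v m = 0) (hw : w m = 0)
    (hvw : w ⬝ᵥ v = 0) : 1 + vecMulVec (s ^ 2 • v) w ∈ H := by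
  have key := mul_mem (mul_mem (one_add_vecMulVec_single_right_mem H hH m hv)
    (one_add_vecMulVec_single_left_mem H hH m hw))
    (mul_mem (one_add_vecMulVec_single_right_mem H hH m (v := -v) (by simp [hv]))
      (one_add_vecMulVec_single_left_mem H hH m (w := -w) (by simp [hw])))
  convert key using 1
  simp [mul_add, add_mul, vecMulVec_mul_vecMulVec, hvw, hv, hw, smul_vecMulVec, vecMulVec_smul,
    smul_smul, sq]
  abel

/-- Split `w` into its `m`-th coordinate and the rest: the rest is a commutator as before, and the
coordinate gives a single column of elementary matrices. -/
theorem one_add_vecMulVec_mem_of_left_apply_eq_zero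
    (hH : ∀ (i j : n) (c : A), i ≠ j → transvection i j (s * c) ∈ H)
    (m : n) {v w : n → A} (hv : v m = 0)
    (hvw : w ⬝ᵥ v = 0) : 1 + vecMulVec (s ^ 2 • v) w ∈ H := by
  have hw : w = (w - Pi.single m (w m)) + Pi.single m (w m) := by simp
  have h0 : (w - Pi.single m (w m)) ⬝ᵥ v = 0 := by simp [sub_dotProduct, hvw, hv]
  have h1 := one_add_vecMulVec_mem_of_apply_eq_zero H hH m hv
    (w := w - Pi.single m (w m)) (by simp) h0
  have h2 := one_add_vecMulVec_single_right_mem H hH m (v := (s * w m) • v) (by simp [hv])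
  have h3 : vecMulVec (s • (s * w m) • v) (Pi.single m 1) =
      vecMulVec (s ^ 2 • v) (Pi.single m (w m)) := by
    ext i j
    by_cases hj : j = m
    · subst hj; simp [vecMulVec_apply]; ring
    · simp [vecMulVec_apply, hj]
  rw [h3] at h2
  rw [hw, ← one_add_vecMulVec_mul_right (by rw [dotProduct_smul, h0, smul_zero])]
  exact mul_mem h1 h2

/-- A submonoid containing the elementary matrices with entries in `s A` contains the matrices
`1 + s ^ 2 v w` with `w` a unimodular row orthogonal to the column `v`. -/
theorem one_add_vecMulVec_mem
    (hH : ∀ (i j : n) (c : A), i ≠ j → transvection i j (s * c) ∈ H)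
    (hn : 2 < Fintype.card n) {v w t : n → A} (hvw : w ⬝ᵥ v = 0)
    (ht : w ⬝ᵥ t = 1) : 1 + vecMulVec (s ^ 2 • v) w ∈ H := by
  -- Koszul relations: `w ⬝ᵥ t = 1` and `w ⬝ᵥ v = 0` give `v = ∑ v_k t_l (w_l e_k - w_k e_l)`. Each
  -- summand is orthogonal to `w` and, as there are at least three indices, vanishes at some `m`.
  have hv : s ^ 2 • v = ∑ k : n × n, s ^ 2 • (v k.1 * t k.2) •
      (Pi.single k.1 (w k.2) - Pi.single k.2 (w k.1) : n → A) := by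
    rw [← Finset.smul_sum]
    congr 1
    ext i
    simp only [Fintype.sum_prod_type, Finset.sum_apply, Pi.smul_apply, Pi.sub_apply, smul_eq_mul,
      mul_sub, Finset.sum_sub_distrib]
    have e1 : ∑ x, ∑ y, v x * t y * (Pi.single x (w y) : n → A) i = v i := by
      rw [Finset.sum_eq_single i (fun b _ hb => by simp [hb.symm]) (by simp)]
      simp only [Pi.single_eq_same, mul_assoc, ← Finset.mul_sum]
      rw [dotProduct_comm] at ht
      rw [show ∑ y, t y * w y = 1 from ht, mul_one]
    have e2 : ∑ x, ∑ y, v x * t y * (Pi.single y (w x) : n → A) i = 0 := by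
      rw [Finset.sum_comm, Finset.sum_eq_single i (fun b _ hb => by simp [hb.symm]) (by simp)]
      have : ∑ x, w x * v x = 0 := hvw
      calc _ = t i * ∑ x, w x * v x := by
            rw [Finset.mul_sum]
            exact Finset.sum_congr rfl fun x _ => by simp; ring
        _ = 0 := by rw [this, mul_zero]
    rw [e1, e2, sub_zero]
  have horth : ∀ k l : n, w ⬝ᵥ ((v k * t l) • (Pi.single k (w l) - Pi.single l (w k))) = 0 := by
    intro k l
    simp [dotProduct_smul, dotProduct_sub, mul_comm]
  rw [hv]
  refine one_add_vecMulVec_sum_left_mem H _ _ _ (fun k _ => ?_) (fun k _ => ?_)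
  · rw [dotProduct_smul, horth, smul_zero]
  · obtain ⟨m, hm⟩ : ∃ m, m ∉ ({k.1, k.2} : Finset n) := by
      by_contra! h
      have := (Finset.card_le_card (fun m _ => h m : Finset.univ ⊆ _)).trans Finset.card_le_two
      rw [Finset.card_univ] at this
      omega
    simp only [Finset.mem_insert, Finset.mem_singleton, not_or] at hm
    exact one_add_vecMulVec_mem_of_left_apply_eq_zero H hH m (by simp [hm.1, hm.2]) (horth _ _)

theorem conj_transvection_mem
    (hH : ∀ (i j : n) (c : A), i ≠ j → transvection i j (s * c) ∈ H)
    (hn : 2 < Fintype.card n) (g : Matrix.SpecialLinearGroup n A) {i j : n}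
    (hij : i ≠ j) (b : A) :
    (g : Matrix n n A) * transvection i j (s ^ 2 * b) *
      ((g⁻¹ : Matrix.SpecialLinearGroup n A) : Matrix n n A) ∈ H := by
  have hg : ((g⁻¹ : Matrix.SpecialLinearGroup n A) : Matrix n n A) * (g : Matrix n n A) = 1 := by
    rw [← Matrix.SpecialLinearGroup.coe_mul, inv_mul_cancel, Matrix.SpecialLinearGroup.coe_one]
  have hg' : (g : Matrix n n A) * ((g⁻¹ : Matrix.SpecialLinearGroup n A) : Matrix n n A) = 1 := by
    rw [← Matrix.SpecialLinearGroup.coe_mul, mul_inv_cancel, Matrix.SpecialLinearGroup.coe_one]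
  have hdot : ∀ k, ((g⁻¹ : Matrix.SpecialLinearGroup n A) : Matrix n n A).row j ⬝ᵥ
      (g : Matrix n n A).col k = (1 : Matrix n n A) j k := fun k => by
    rw [← hg]; rfl
  have := one_add_vecMulVec_mem H hH hn (v := b • (g : Matrix n n A).col i)
    (w := ((g⁻¹ : Matrix.SpecialLinearGroup n A) : Matrix n n A).row j)
    (t := (g : Matrix n n A).col j)
    (by rw [dotProduct_smul, hdot, one_apply_ne hij.symm, smul_zero])
    (by rw [hdot, one_apply_eq])
  convert this using 1
  rw [← mul_one (s ^ 2 * b), transvection_eq_one_add_vecMulVec, mul_add, add_mul, mul_one, hg',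
    mul_vecMulVec, vecMulVec_mul, mulVec_single, single_one_vecMul]
  congr 2
  ext k
  simp
  ring

end Matrices

/-! ### The ring `A[X]/(X² - s² X)` and its two evaluations -/

section DoubleRing

variable {A : Type u} [CommRing A] (s : A)

open Polynomial in
/-- Evaluation of `A[X]/(X ^ 2 - s ^ 2 X)` at a root `a` of `X ^ 2 - s ^ 2 X`. -/
noncomputable def evalDouble (a : A) (ha : a ^ 2 - s ^ 2 * a = 0) : DoubleRing A s →+* A :=
  Ideal.Quotient.lift _ (evalRingHom a) fun f hf => by
    obtain ⟨g, rfl⟩ := Ideal.mem_span_singleton.1 hf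
    simp [ha]

/-- Evaluation at `0`. -/
noncomputable abbrev evalZero : DoubleRing A s →+* A := evalDouble s 0 (by simp)

/-- Evaluation at `s ^ 2`. -/
noncomputable abbrev evalSq : DoubleRing A s →+* A := evalDouble s (s ^ 2) (by ring)

theorem exists_evalSq_eq (z : DoubleRing A s) :
    ∃ b, evalSq s z = s ^ 2 * b + evalZero s z := by
  obtain ⟨f, rfl⟩ := Ideal.Quotient.mk_surjective z
  obtain ⟨b, hb⟩ := Polynomial.sub_dvd_eval_sub (s ^ 2) 0 f
  refine ⟨b, ?_⟩
  simp only [evalDouble, Ideal.Quotient.lift_mk, Polynomial.coe_evalRingHom]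
  rw [sub_zero] at hb
  rw [← hb]
  ring

theorem evalSq_mul_evalZero_inv_mem {n : ℕ} (hn : 2 < n)
    (H : Submonoid (Matrix (Fin n) (Fin n) A))
    (hH : ∀ (i j : Fin n) (c : A), i ≠ j → transvection i j (s * c) ∈ H)
    {g : Matrix.SpecialLinearGroup (Fin n) (DoubleRing A s)} (hg : g ∈ En n (DoubleRing A s)) :
    ((g.map (evalSq s) * (g.map (evalZero s))⁻¹ : Matrix.SpecialLinearGroup (Fin n) A) :
      Matrix (Fin n) (Fin n) A) ∈ H := by
  have key : ∀ (x y : Matrix.SpecialLinearGroup (Fin n) (DoubleRing A s)) (i j : Fin n)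
      (c : DoubleRing A s), i ≠ j → (y : Matrix _ _ _) = transvection i j c →
      ((x.map (evalSq s) * (x.map (evalZero s))⁻¹ : Matrix.SpecialLinearGroup (Fin n) A) :
        Matrix (Fin n) (Fin n) A) ∈ H →
      (((x * y).map (evalSq s) * ((x * y).map (evalZero s))⁻¹ : Matrix.SpecialLinearGroup (Fin n) A) :
        Matrix (Fin n) (Fin n) A) ∈ H := by
    intro x y i j c hij hy hx
    obtain ⟨b, hb⟩ := exists_evalSq_eq s c
    have hy' : ((y.map (evalSq s) * (y.map (evalZero s))⁻¹ : Matrix.SpecialLinearGroup (Fin n) A) :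
        Matrix (Fin n) (Fin n) A) = transvection i j (s ^ 2 * b) := by
      have hmap : ∀ f : DoubleRing A s →+* A, (y.map f : Matrix (Fin n) (Fin n) A) =
          transvection i j (f c) := fun f => by
        rw [Matrix.SpecialLinearGroup.map_apply_coe, hy]
        simp [transvection, Matrix.map_add, map_single]
      have h1 : (y.map (evalSq s) : Matrix (Fin n) (Fin n) A) =
          transvection i j (s ^ 2 * b) * (y.map (evalZero s) : Matrix (Fin n) (Fin n) A) := by
        rw [hmap, hmap, transvection_mul_transvection_same _ _ hij, hb]
      rw [Matrix.SpecialLinearGroup.coe_mul, h1, mul_assoc, ← Matrix.SpecialLinearGroup.coe_mul,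
        mul_inv_cancel, Matrix.SpecialLinearGroup.coe_one, mul_one]
    -- `(xy)(s²) (xy)(0)⁻¹` is `x(s²) x(0)⁻¹` times the conjugate of `y(s²) y(0)⁻¹` by `x(0)`.
    have := mul_mem hx (conj_transvection_mem H hH (by simpa using hn) (x.map (evalZero s)) hij b)
    rw [← hy', ← Matrix.SpecialLinearGroup.coe_mul, ← Matrix.SpecialLinearGroup.coe_mul,
      ← Matrix.SpecialLinearGroup.coe_mul] at this
    convert this using 2
    rw [map_mul, map_mul]
    group
  refine Subgroup.closure_induction_right (p := fun g _ =>
    ((g.map (evalSq s) * (g.map (evalZero s))⁻¹ : Matrix.SpecialLinearGroup (Fin n) A) :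
      Matrix (Fin n) (Fin n) A) ∈ H) ?_ ?_ ?_ hg
  · simp [one_mem]
  · rintro x _ y ⟨i, j, c, hij, hy⟩ hx
    exact key x y i j c hij hy hx
  · rintro x _ y ⟨i, j, c, hij, hy⟩ hx
    refine key x y⁻¹ i j (-c) hij ?_ hx
    calc (y⁻¹ : Matrix.SpecialLinearGroup (Fin n) (DoubleRing A s)).1
        = y⁻¹.1 * (y.1 * transvection i j (-c)) := by
          rw [hy, transvection_mul_transvection_same _ _ hij, add_neg_cancel, transvection_zero,
            mul_one]
      _ = transvection i j (-c) := by
          rw [← mul_assoc, ← Matrix.SpecialLinearGroup.coe_mul, inv_mul_cancel,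
            Matrix.SpecialLinearGroup.coe_one, one_mul]

/-- The class of `X`. -/
noncomputable abbrev doubleX : DoubleRing A s := Ideal.Quotient.mk _ Polynomial.X

theorem doubleX_mul_self : doubleX s * doubleX s = algebraMap A _ (s ^ 2) * doubleX s := by
  rw [← sub_eq_zero, ← sq]
  exact Ideal.Quotient.eq_zero_iff_mem.2 (Ideal.mem_span_singleton_self _)

theorem evalDouble_doubleX (a : A) (ha) : evalDouble s a ha (doubleX s) = a := by
  simp [evalDouble]

theorem evalDouble_algebraMap (a : A) (ha) (b : A) :
    evalDouble s a ha (algebraMap A _ b) = b := by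
  change evalDouble s a ha (Ideal.Quotient.mk _ (Polynomial.C b)) = b
  simp [evalDouble]

/-- The lift `e₀ + X w` of the row `e₀ + s ^ 2 w`. -/
noncomputable def doubleRow {r : ℕ} (w : Fin (r + 1) → A) : Fin (r + 1) → DoubleRing A s :=
  fun i => (Pi.single 0 1 : Fin (r + 1) → DoubleRing A s) i + doubleX s * algebraMap A _ (w i)

theorem doubleRow_mem_Um {r : ℕ} {w : Fin (r + 1) → A}
    (h : Pi.single 0 1 + s ^ 2 • w ∈ Um A (Fin (r + 1) → A)) :
    doubleRow s w ∈ Um (DoubleRing A s) (Fin (r + 1) → DoubleRing A s) := by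
  obtain ⟨ψ, hψ⟩ := h
  have hψ' : ∀ v : Fin (r + 1) → A, ψ v = ∑ i, v i * ψ (Pi.single i 1) := fun v => by
    conv_lhs => rw [← Finset.univ_sum_single v, map_sum]
    exact Finset.sum_congr rfl fun i _ => by
      rw [← smul_eq_mul, ← map_smul, ← Pi.single_smul, smul_eq_mul, mul_one]
  rw [map_add, map_smul, smul_eq_mul] at hψ
  let Ψ : Module.Dual (DoubleRing A s) (Fin (r + 1) → DoubleRing A s) :=
    ∑ i, algebraMap A (DoubleRing A s) (ψ (Pi.single i 1)) • LinearMap.proj i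
  have hΨ : Ψ (doubleRow s w) = algebraMap A _ (ψ (Pi.single 0 1)) +
      doubleX s * algebraMap A _ (ψ w) := by
    rw [hψ' w, map_sum]
    simp only [Ψ, doubleRow, LinearMap.sum_apply, LinearMap.smul_apply, LinearMap.proj_apply,
      smul_eq_mul, mul_add, Finset.sum_add_distrib, Finset.mul_sum]
    congr 1
    · rw [Finset.sum_eq_single 0 (fun b _ hb => by simp [hb]) (by simp)]
      simp
    · exact Finset.sum_congr rfl fun i _ => by rw [map_mul]; ring
  -- With `ρ = doubleRow s w`, `X² = s² X` and `hψ` give `X Ψ(ρ) = X`. As `ρ 0 = 1 + X w₀`, the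
  -- value is `ρ 0 - X w₀ Ψ(ρ) = 1`.
  refine ⟨LinearMap.proj 0 + Ψ - (doubleRow s w 0) • Ψ, ?_⟩
  have h1 := congrArg (algebraMap A (DoubleRing A s)) hψ
  rw [map_add, map_mul, map_one] at h1
  simp only [LinearMap.sub_apply, LinearMap.add_apply, LinearMap.smul_apply, LinearMap.proj_apply,
    smul_eq_mul, hΨ]
  simp only [doubleRow, Pi.single_eq_same]
  linear_combination (- doubleX s * algebraMap A _ (w 0)) * h1 -
    algebraMap A _ (w 0) * algebraMap A _ (ψ w) * doubleX_mul_self s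

theorem evalDouble_doubleRow {r : ℕ} (w : Fin (r + 1) → A) (a : A) (ha) :
    (fun i => evalDouble s a ha (doubleRow s w i)) = Pi.single 0 1 + a • w := by
  ext i
  simp only [doubleRow, map_add, map_mul, evalDouble_doubleX, evalDouble_algebraMap, Pi.add_apply,
    Pi.smul_apply, smul_eq_mul]
  congr 1
  by_cases hi : i = 0
  · subst hi; simp
  · simp [hi]

end DoubleRing

/-! ### Lifting row operations to `E(A ⊕ P)` -/

section Lifting

variable {A : Type u} [CommRing A] {P : Type v} [AddCommGroup P] [Module A P] {r : ℕ}

/-- The map `(b, f) ↦ (b, ∑ i, f i • p i)`. -/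
noncomputable def rowMap (p : Fin r → P) : (Fin (r + 1) → A) →ₗ[A] A × P :=
  LinearMap.prod (LinearMap.proj 0)
    (∑ i : Fin r, (LinearMap.proj i.succ : (Fin (r + 1) → A) →ₗ[A] A).smulRight (p i))

theorem rowMap_apply (p : Fin r → P) (f : Fin (r + 1) → A) :
    rowMap p f = (f 0, ∑ i : Fin r, f i.succ • p i) := by
  simp [rowMap]

/-- The matrices whose action on rows lifts along `rowMap p` to an element of `E(A ⊕ P)`. -/
def liftable (p : Fin r → P) : Submonoid (Matrix (Fin (r + 1)) (Fin (r + 1)) A) where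
  carrier := {M | ∃ σ ∈ E A (A × P), ∀ f, σ (rowMap p f) = rowMap p (f ᵥ* M)}
  one_mem' := ⟨1, one_mem _, fun f => by simp⟩
  mul_mem' := by
    rintro M N ⟨σ, hσ, h⟩ ⟨τ, hτ, h'⟩
    exact ⟨τ * σ, mul_mem hτ hσ, fun f => by
      rw [LinearEquiv.mul_apply, h, h', vecMul_vecMul]⟩

theorem vecMul_transvection {n : Type*} [Fintype n] [DecidableEq n] (f : n → A) (i j : n) (c : A) :
    f ᵥ* transvection i j c = f + Pi.single j (f i * c) := by
  rw [← mul_one c, transvection_eq_one_add_vecMulVec, vecMul_add, vecMul_one, vecMul_vecMulVec]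
  congr 1
  ext k
  by_cases hk : k = j
  · subst hk; simp
  · simp [hk]

/-- The transvection `(b, q) ↦ (b, q + b m)`. -/
theorem exists_mem_E_fst (m : P) :
    ∃ σ ∈ E A (A × P), ∀ x : A × P, σ x = (x.1, x.2 + x.1 • m) := by
  have h : LinearMap.fst A A P ((0, m) : A × P) = 0 := rfl
  refine ⟨LinearEquiv.transvection h, Subgroup.subset_closure ⟨_, _, h, Or.inr ?_, rfl⟩, ?_⟩
  · exact ⟨Module.Dual.eval A (A × P) (1, 0), by simp⟩
  · intro x
    rw [LinearEquiv.transvection.apply]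
    simp [Prod.ext_iff]

/-- The transvection `(b, q) ↦ (b + φ(q), q)`. -/
theorem exists_mem_E_snd (φ : Module.Dual A P) :
    ∃ σ ∈ E A (A × P), ∀ x : A × P, σ x = (x.1 + φ x.2, x.2) := by
  have h : (φ ∘ₗ LinearMap.snd A A P) ((1, 0) : A × P) = 0 := by simp
  refine ⟨LinearEquiv.transvection h, Subgroup.subset_closure ⟨_, _, h, Or.inl ?_, rfl⟩, ?_⟩
  · exact ⟨LinearMap.fst A A P, rfl⟩
  · intro x
    rw [LinearEquiv.transvection.apply]
    simp [Prod.ext_iff]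

theorem transvection_zero_succ_mem_liftable (p : Fin r → P) (i : Fin r) (c : A) :
    transvection 0 i.succ c ∈ liftable (A := A) p := by
  obtain ⟨σ, hσ, h⟩ := exists_mem_E_fst (A := A) (c • p i)
  refine ⟨σ, hσ, fun f => ?_⟩
  rw [h, vecMul_transvection, map_add]
  simp only [rowMap_apply, Prod.mk_add_mk]
  have : ∑ k : Fin r, (Pi.single i.succ (f 0 * c) : Fin (r + 1) → A) k.succ • p k =
      f 0 • c • p i := by
    rw [Finset.sum_eq_single i (fun k _ hk => by simp [hk]) (by simp)]
    simp [mul_smul]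
  rw [this]
  simp

theorem transvection_succ_zero_mem_liftable {p : Fin r → P} {φ : Fin r → Module.Dual A P} {s : A}
    (hφ : ∀ i j, φ i (p j) = if i = j then s else 0) (j : Fin r) (c : A) :
    transvection j.succ 0 (s * c) ∈ liftable (A := A) p := by
  obtain ⟨σ, hσ, h⟩ := exists_mem_E_snd (A := A) (c • φ j)
  refine ⟨σ, hσ, fun f => ?_⟩
  rw [h, vecMul_transvection, map_add]
  simp only [rowMap_apply, Prod.mk_add_mk]
  simp [hφ]
  ring

theorem transvection_mem_liftable {p : Fin r → P} {φ : Fin r → Module.Dual A P} {s : A}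
    (hφ : ∀ i j, φ i (p j) = if i = j then s else 0) (i j : Fin (r + 1)) (c : A) (hij : i ≠ j) :
    transvection i j (s * c) ∈ liftable (A := A) p := by
  induction i using Fin.cases with
  | zero =>
    induction j using Fin.cases with
    | zero => exact absurd rfl hij
    | succ j => exact transvection_zero_succ_mem_liftable p j _
  | succ i =>
    induction j using Fin.cases with
    | zero => exact transvection_succ_zero_mem_liftable hφ i c
    | succ j =>
      -- Commutator of `E_{i0}(s c)` and `E_{0j}(1)`: only the first needs the factor `s`, so a
      -- single `s` survives.
      have := mul_mem (mul_mem (transvection_succ_zero_mem_liftable hφ i c)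
        (transvection_zero_succ_mem_liftable p j (1 : A)))
        (mul_mem (transvection_succ_zero_mem_liftable hφ i (-c))
          (transvection_zero_succ_mem_liftable p j (-1 : A)))
      convert this using 1
      have h0 : ∀ k : Fin r, (0 : Fin (r + 1)) ≠ k.succ := fun k => (Fin.succ_ne_zero k).symm
      simp [transvection, mul_add, add_mul, hij.symm, h0, single_mul_single_of_ne, ← single_neg]
      abel

/-- A unimodular row `e₀ + s ^ 2 w` whose image has been completed over the double ring. -/
theorem exists_mem_E_rowMap {s : A} (hr : 2 ≤ r) {p : Fin r → P} {φ : Fin r → Module.Dual A P}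
    (hφ : ∀ i j, φ i (p j) = if i = j then s else 0)
    (hR : ∀ x ∈ Um (DoubleRing A s) (Fin (r + 1) → DoubleRing A s),
      ∀ y ∈ Um (DoubleRing A s) (Fin (r + 1) → DoubleRing A s),
        ∃ g ∈ En (r + 1) (DoubleRing A s),
          Matrix.vecMul x (g : Matrix (Fin (r + 1)) (Fin (r + 1)) (DoubleRing A s)) = y)
    {w : Fin (r + 1) → A} (hw : Pi.single 0 1 + s ^ 2 • w ∈ Um A (Fin (r + 1) → A)) :
    ∃ σ ∈ E A (A × P), σ (rowMap p (Pi.single 0 1 + s ^ 2 • w)) = (1, 0) := by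
  obtain ⟨g, hg, hgw⟩ := hR _ (doubleRow_mem_Um s hw) (Pi.single 0 1)
    ⟨LinearMap.proj 0, by simp⟩
  obtain ⟨σ, hσ, h⟩ := evalSq_mul_evalZero_inv_mem s (by omega) (liftable p)
    (transvection_mem_liftable hφ) hg
  refine ⟨σ, hσ, ?_⟩
  have hev : ∀ (a : A) (ha : a ^ 2 - s ^ 2 * a = 0),
      (Pi.single 0 1 + a • w) ᵥ* (g.map (evalDouble s a ha) : Matrix (Fin (r + 1)) (Fin (r + 1)) A) = Pi.single 0 1 := by
    intro a ha
    rw [← evalDouble_doubleRow s w a ha]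
    ext i
    have := congrArg (evalDouble s a ha) (congrFun hgw i)
    rw [RingHom.map_vecMul] at this
    refine this.trans ?_
    by_cases hi : i = 0
    · subst hi; simp
    · simp [hi]
  have h0 := hev 0 (by simp)
  rw [zero_smul, add_zero] at h0
  have h1 : (Pi.single 0 1 : Fin (r + 1) → A) ᵥ*
      (((g.map (evalZero s))⁻¹ : Matrix.SpecialLinearGroup (Fin (r + 1)) A) : Matrix (Fin (r + 1)) (Fin (r + 1)) A) =
      Pi.single 0 1 := by
    conv_lhs => rw [← h0]
    rw [vecMul_vecMul, ← Matrix.SpecialLinearGroup.coe_mul, mul_inv_cancel, Matrix.SpecialLinearGroup.coe_one,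
      vecMul_one]
  rw [h, Matrix.SpecialLinearGroup.coe_mul, ← vecMul_vecMul, hev, h1, rowMap_apply]
  simp

theorem exists_mem_E_map_eq_one_zero {s : A} (hr : 2 ≤ r) {p : Fin r → P}
    {φ : Fin r → Module.Dual A P} (hφ : ∀ i j, φ i (p j) = if i = j then s else 0)
    (hp : ∀ x : P, s • x ∈ Submodule.span A (Set.range p))
    (hR : ∀ x ∈ Um (DoubleRing A s) (Fin (r + 1) → DoubleRing A s),
      ∀ y ∈ Um (DoubleRing A s) (Fin (r + 1) → DoubleRing A s),
        ∃ g ∈ En (r + 1) (DoubleRing A s),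
          Matrix.vecMul x (g : Matrix (Fin (r + 1)) (Fin (r + 1)) (DoubleRing A s)) = y)
    {x : A × P} (hx : x ∈ UmRel A P (Ideal.span {s ^ 2})) :
    ∃ σ ∈ E A (A × P), σ x = (1, 0) := by
  obtain ⟨⟨ψ, hψ⟩, ha, hm⟩ := hx
  obtain ⟨c, hc⟩ := Ideal.mem_span_singleton'.1 ha
  rw [Submodule.ideal_span_singleton_smul] at hm
  obtain ⟨q, -, hq⟩ := hm
  replace hq : s ^ 2 • q = x.2 := hq
  obtain ⟨d, hd⟩ := (Submodule.mem_span_range_iff_exists_fun A).1 (hp (-(c • q)))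
  -- This replaces `x.2` by `(1 - x.1) x.2 = -c s⁴ q = s³ ∑ d i • p i`. The gained factor `s²` is
  -- what allows `w = (c, s d)`.
  obtain ⟨σ, hσ, h⟩ := exists_mem_E_fst (A := A) (-x.2)
  let w : Fin (r + 1) → A := Fin.cons c (s • d)
  have hw : σ x = rowMap p (Pi.single 0 1 + s ^ 2 • w) := by
    rw [h, rowMap_apply]
    refine Prod.ext ?_ ?_
    · simp only [w, Pi.add_apply, Pi.single_eq_same, Pi.smul_apply, Fin.cons_zero, smul_eq_mul]
      linear_combination -hc
    · simp only [w, Pi.add_apply, Pi.smul_apply, Fin.cons_succ, smul_eq_mul, ne_eq,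
        Fin.succ_ne_zero, not_false_eq_true, Pi.single_eq_of_ne, zero_add, mul_smul,
        ← Finset.smul_sum, hd]
      rw [← hq, show x.1 = 1 + c * s ^ 2 by rw [hc]; ring]
      module
  have hU : Pi.single 0 1 + s ^ 2 • w ∈ Um A (Fin (r + 1) → A) := by
    refine ⟨ψ ∘ₗ σ.symm.toLinearMap ∘ₗ rowMap p, ?_⟩
    rw [LinearMap.comp_apply, LinearMap.comp_apply, ← hw]
    simpa using hψ
  obtain ⟨τ, hτ, h'⟩ := exists_mem_E_rowMap hr hφ hR hU
  exact ⟨τ * σ, mul_mem hτ hσ, by rw [LinearEquiv.mul_apply, hw, h']⟩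

end Lifting

end Lindel

theorem lemmac1 {A : Type u} [CommRing A] [IsNoetherianRing A]
    {P : Type v} [AddCommGroup P] [Module A P] [Module.Finite A P] [Module.Projective A P]
    (r : ℕ) (hr : 2 ≤ r) (hrank : ∀ 𝔭 : PrimeSpectrum A, Module.rankAtStalk P 𝔭 = r)
    (s : A) (hs : Lindel.IsLindelElement P r s)
    (hR : ∀ x ∈ Lindel.Um (Lindel.DoubleRing A s) (Fin (r + 1) → Lindel.DoubleRing A s),
      ∀ y ∈ Lindel.Um (Lindel.DoubleRing A s) (Fin (r + 1) → Lindel.DoubleRing A s),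
        ∃ g ∈ Lindel.En (r + 1) (Lindel.DoubleRing A s),
          Matrix.vecMul x (g : Matrix (Fin (r + 1)) (Fin (r + 1)) (Lindel.DoubleRing A s)) = y) :
    ∀ x ∈ Lindel.UmRel A P (Ideal.span {s ^ 2}), ∀ y ∈ Lindel.UmRel A P (Ideal.span {s ^ 2}),
      ∃ σ ∈ Lindel.E A (A × P), σ x = y := by
  obtain ⟨p, φ, hφ, hp⟩ := hs.exists_dual
  intro x hx y hy
  obtain ⟨σ, hσ, h⟩ := Lindel.exists_mem_E_map_eq_one_zero hr hφ hp hR hx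
  obtain ⟨τ, hτ, h'⟩ := Lindel.exists_mem_E_map_eq_one_zero hr hφ hp hR hy
  refine ⟨τ⁻¹ * σ, mul_mem (inv_mem hτ) hσ, ?_⟩
  rw [LinearEquiv.mul_apply, h, ← h', ← LinearEquiv.mul_apply, inv_mul_cancel,
    LinearEquiv.coe_one, id]
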